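/- Let $\mathrm{Homeo}^+(\mathbb R)$ be the group of orientation preserving homeomorphisms of $\mathbb R$, and write $\operatorname{supp} f=\{x\in\mathbb R : f(x)\neq x\}$. An \emph{$n$-chain of intervals} is a family of nonempty open (possibly unbounded) intervals $J_1,\dots,J_n\subseteq\mathbb R$ such that $J_i\cap J_k=\varnothing$ whenever $|i-k|>1$, and such that $J_i\cap J_{i+1}$ is a nonempty proper subinterval of both $J_i$ and $J_{i+1}$ for $1\le i\le n-1$. For $n\ge 2$, an \emph{$n$-chain group} is a subgroup $G=\langle f_1,\dots,f_n\rangle\le\mathrm{Homeo}^+(\mathbb R)$ such that the sets $\operatorname{supp} f_i$ form an $n$-chain of intervals $J_i=\operatorname{supp} f_i$ with $\inf J_i<\inf J_{i+1}$ for each $i<n$ (infima taken in $[-\infty,\infty]$), such that $f_i(t)\ge t$ for all $i$ and all $t\in\mathbb R$, and such that for each $1\le i\le n-1$ the group $\langle f_i,f_{i+1}\rangle$ is isomorphic to Thompson's group $F$. Here $F$ is realized as $\langle a,b\rangle\le \mathrm{Homeo}^+(\mathbb R)$, where $a(x)=x+1$, and $b(x)=x$ for $x\le 0$, $b(x)=2x$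 for $0<x<1$, $b(x)=x+1$ for $x\ge 1$. \textbf{Proposition.} For each integer $n\ge 3$ there exists an $n$-chain group whose commutator subgroup is not simple. -/

import Mathlib

namespace ChainGroups

/-- `Homeo⁺(ℝ)`: the group (under composition) of orientation preserving, that is strictly
increasing, homeomorphisms of the real line. -/
def HomeoPlus : Subgroup (ℝ ≃ₜ ℝ) where
  carrier := {f | StrictMono f}
  mul_mem' := fun {f g} hf hg => StrictMono.comp (g := f) (f := g) hf hg
  one_mem' := fun _ _ h => h
  inv_mem' := by
    intro f hf x y hxy
    have hf' : StrictMono f := hf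
    have hx : f (f⁻¹ x) = x := f.apply_symm_apply x
    have hy : f (f⁻¹ y) = y := f.apply_symm_apply y
    rw [← hf'.lt_iff_lt, hx, hy]
    exact hxy

/-- An order isomorphism of `ℝ`, as an orientation preserving homeomorphism. -/
def HomeoPlus.ofOrderIso (e : ℝ ≃o ℝ) : HomeoPlus :=
  ⟨e.toHomeomorph, e.strictMono⟩

/-- The support `{x | f x ≠ x}` (no closure is taken). -/
def supp (f : HomeoPlus) : Set ℝ :=
  {x | (f : ℝ ≃ₜ ℝ) x ≠ x}

/-! ### Thompson's group `F` -/

/-- The translation `a(x) = x + 1`. -/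
noncomputable def thompsonA : HomeoPlus :=
  HomeoPlus.ofOrderIso (OrderIso.addRight (1 : ℝ))

/-- `b(x) = x` for `x ≤ 0`, `b(x) = 2x` for `0 < x < 1`, `b(x) = x + 1` for `1 ≤ x`. -/
noncomputable def thompsonBFun (x : ℝ) : ℝ :=
  if x ≤ 0 then x else if x < 1 then 2 * x else x + 1

theorem thompsonBFun_strictMono : StrictMono thompsonBFun := by
  intro x y h
  unfold thompsonBFun
  split_ifs <;> linarith

theorem thompsonBFun_surjective : Function.Surjective thompsonBFun := by
  intro y
  rcases le_or_gt y 0 with h | h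
  · exact ⟨y, by simp [thompsonBFun, h]⟩
  · rcases lt_or_ge y 2 with h2 | h2
    · refine ⟨y / 2, ?_⟩
      unfold thompsonBFun
      split_ifs <;> linarith
    · refine ⟨y - 1, ?_⟩
      unfold thompsonBFun
      split_ifs <;> linarith

/-- The piecewise linear homeomorphism `b`. -/
noncomputable def thompsonB : HomeoPlus :=
  HomeoPlus.ofOrderIso
    (thompsonBFun_strictMono.orderIsoOfSurjective thompsonBFun thompsonBFun_surjective)

/-- Thompson's group `F`, in its standard copy `⟨a, b⟩ ≤ Homeo⁺(ℝ)`. -/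
noncomputable def ThompsonF : Subgroup HomeoPlus :=
  Subgroup.closure {thompsonA, thompsonB}

/-! ### Chains of intervals and chain groups -/

/-- The left endpoint `∂⁻J` of an interval, possibly `-∞`. -/
noncomputable def leftEnd (J : Set ℝ) : EReal :=
  sInf ((fun x : ℝ => (x : EReal)) '' J)

/-- An `n`-chain of intervals: nonempty open (possibly unbounded) intervals `J₁, …, Jₙ` such that
non-consecutive ones are disjoint and `Jᵢ ∩ Jᵢ₊₁` is a nonempty proper subset (automatically an
interval) of both `Jᵢ` and `Jᵢ₊₁`. -/
structure IsChainOfIntervals {n : ℕ} (J : Fin n → Set ℝ) : Prop where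
  isOpen : ∀ i, IsOpen (J i)
  ordConnected : ∀ i, (J i).OrdConnected
  nonempty : ∀ i, (J i).Nonempty
  disjoint : ∀ i k : Fin n, i.val + 1 < k.val → Disjoint (J i) (J k)
  inter_nonempty : ∀ i k : Fin n, i.val + 1 = k.val → (J i ∩ J k).Nonempty
  inter_ssubset_left : ∀ i k : Fin n, i.val + 1 = k.val → J i ∩ J k ⊂ J i
  inter_ssubset_right : ∀ i k : Fin n, i.val + 1 = k.val → J i ∩ J k ⊂ J k

/-- The homeomorphisms `f₁, …, fₙ` generate a prechain group: `n ≥ 2`, the supports form an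
`n`-chain of intervals, listed by increasing left endpoint, and `fᵢ(t) ≥ t` for all `t`. -/
structure IsPrechain {n : ℕ} (f : Fin n → HomeoPlus) : Prop where
  two_le : 2 ≤ n
  chain : IsChainOfIntervals fun i => supp (f i)
  leftEnd_lt : ∀ i k : Fin n, i.val + 1 = k.val → leftEnd (supp (f i)) < leftEnd (supp (f k))
  le_apply : ∀ (i : Fin n) (t : ℝ), t ≤ (f i : ℝ ≃ₜ ℝ) t

/-- `G ≤ Homeo⁺(ℝ)` is an `n`-chain group: it is the prechain group generated by some
`f₁, …, fₙ`, and each `⟨fᵢ, fᵢ₊₁⟩` is isomorphic to Thompson's group `F`. -/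
def IsChainGroup (n : ℕ) (G : Subgroup HomeoPlus) : Prop :=
  ∃ f : Fin n → HomeoPlus,
    IsPrechain f ∧
    (∀ i k : Fin n, i.val + 1 = k.val →
      Nonempty (Subgroup.closure {f i, f k} ≃* ThompsonF)) ∧
    G = Subgroup.closure (Set.range f)

end ChainGroups

namespace ChainGroups

/-! The generators come from copies `bumpAt (4 * m)` of one bump with slopes 1, 3 and 1/3. Two
neighbouring copies generate a copy of F with an exceptional minimal set: it is not conjugate to the
standard action, but `blow`, which jumps at the dyadic rationals, intertwines the two. All copies
preserve `cells`, the even translates of the Cantor set, since their pieces are even translations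
and scalings by 3 or 1/3.

The gaps of `cells` leave room for a homeomorphism `twist` that fixes `cells` pointwise and commutes
with `b = bumpAt 0`. Conjugating every bump to the right of `b` by `twist` keeps each consecutive
pair isomorphic to F: the first pair is untouched, and since `twist` fixes `b` under conjugation,
every later pair is conjugated as a whole (`nonempty_closure_chainGen_equiv`).

The two halves of the chain now disagree inside the gaps. One homeomorphism `core` is a product of
conjugates of commutators both in `bumpAt (-4)`, `b` and in `b`, `bumpAt 4` (`core_eq_left`,
`core_eq_right`). After twisting, the second word gives `twist * core * twist⁻¹`. The quotient of
the two values lies in the commutator subgroup, is nontrivial because `core` and `twist` do not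
commute, and is trivial on `cells`, whereas `core` moves a point of `cells`. The pointwise
stabilizer of `cells` therefore cuts out a proper nontrivial normal subgroup. -/

instance : CoeFun HomeoPlus fun _ => ℝ → ℝ := ⟨fun g => (g : ℝ ≃ₜ ℝ)⟩

namespace HomeoPlus

theorem strictMono (g : HomeoPlus) : StrictMono g := g.2

theorem injective (g : HomeoPlus) : Function.Injective g := (HomeoPlus.strictMono g).injective

@[simp] theorem one_apply (x : ℝ) : (1 : HomeoPlus) x = x := rfl

@[simp] theorem mul_apply (g k : HomeoPlus) (x : ℝ) : (g * k) x = g (k x) := rfl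

@[simp] theorem apply_inv_apply (g : HomeoPlus) (x : ℝ) : g (g⁻¹ x) = x :=
  (g : ℝ ≃ₜ ℝ).apply_symm_apply x

@[simp] theorem inv_apply_apply (g : HomeoPlus) (x : ℝ) : g⁻¹ (g x) = x :=
  (g : ℝ ≃ₜ ℝ).symm_apply_apply x

theorem ext {g k : HomeoPlus} (h : ∀ x, g x = k x) : g = k :=
  Subtype.ext (Homeomorph.ext h)

theorem inv_apply_eq {g : HomeoPlus} {x y : ℝ} (h : g x = y) : g⁻¹ y = x := by
  rw [← h, inv_apply_apply]

/-- A strictly increasing surjection of the line, as an element of `HomeoPlus`. -/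
noncomputable def mk' (f : ℝ → ℝ) (hm : StrictMono f) (hs : Function.Surjective f) : HomeoPlus :=
  ofOrderIso (hm.orderIsoOfSurjective f hs)

@[simp] theorem mk'_apply (f : ℝ → ℝ) (hm : StrictMono f) (hs : Function.Surjective f) (x : ℝ) :
    mk' f hm hs x = f x := rfl

/-- The translation by `c`. -/
noncomputable def translate (c : ℝ) : HomeoPlus := ofOrderIso (OrderIso.addRight c)

@[simp] theorem translate_apply (c x : ℝ) : translate c x = x + c := rfl

@[simp] theorem translate_inv_apply (c x : ℝ) : (translate c)⁻¹ x = x - c :=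
  inv_apply_eq (by simp)

end HomeoPlus

@[simp] theorem thompsonA_apply (x : ℝ) : thompsonA x = x + 1 := rfl

@[simp] theorem thompsonB_apply (x : ℝ) : thompsonB x = thompsonBFun x := rfl

/-! ### Comparing two-generator groups -/

theorem closure_pair_mul_left {G : Type*} [Group G] (x y : G) :
    Subgroup.closure {x * y, y} = Subgroup.closure {x, y} := by
  have hy : ∀ z : G, y ∈ Subgroup.closure {z, y} := fun z =>
    Subgroup.subset_closure (by simp)
  have hx : ∀ z : G, z ∈ Subgroup.closure {z, y} := fun z =>
    Subgroup.subset_closure (by simp)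
  apply le_antisymm
  · rw [Subgroup.closure_le]
    rintro z (rfl | rfl)
    · exact mul_mem (hx x) (hy x)
    · exact hy x
  · rw [Subgroup.closure_le]
    rintro z (rfl | rfl)
    · simpa using mul_mem (hx (z * y)) (inv_mem (hy (z * y)))
    · exact hy _

/-- Conjugation identifies the groups generated by two conjugate pairs. -/
theorem nonempty_closure_conj_equiv {G : Type*} [Group G] (k x y : G) :
    Nonempty (Subgroup.closure {k * x * k⁻¹, k * y * k⁻¹} ≃* Subgroup.closure {x, y}) := by
  have h : (Subgroup.closure {x, y}).map (MulAut.conj k).toMonoidHom =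
      Subgroup.closure {k * x * k⁻¹, k * y * k⁻¹} := by
    rw [MonoidHom.map_closure, Set.image_pair]
    simp
  rw [← h]
  exact ⟨(Subgroup.equivMapOfInjective _ _ (MulAut.conj k).injective).symm⟩

theorem range_lift_pair {G : Type*} [Group G] (x y : G) :
    (FreeGroup.lift fun i : Bool => cond i x y).range = Subgroup.closure {x, y} := by
  rw [FreeGroup.range_lift_eq_closure]
  congr 1
  ext z
  simp [eq_comm, or_comm]

/-- Two pairs satisfying the same relations generate isomorphic groups. -/
theorem nonempty_closure_equiv_of_relations {G H : Type*} [Group G] [Group H] (x y : G) (a b : H)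
    (h : ∀ w : FreeGroup Bool, FreeGroup.lift (fun i : Bool => cond i x y) w = 1 ↔
      FreeGroup.lift (fun i : Bool => cond i a b) w = 1) :
    Nonempty (Subgroup.closure {x, y} ≃* Subgroup.closure {a, b}) := by
  rw [← range_lift_pair, ← range_lift_pair]
  refine ⟨(QuotientGroup.quotientKerEquivRange _).symm.trans
    ((QuotientGroup.quotientMulEquivOfEq ?_).trans (QuotientGroup.quotientKerEquivRange _))⟩
  ext w
  exact h w

/-- Two pairs of homeomorphisms are intertwined by a family `E t` of maps of the line, one of
them injective, outside of whose images the first pair acts trivially. Then they generate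
isomorphic groups. -/
theorem nonempty_closure_equiv_of_intertwine {T : Type*} (E : T → ℝ → ℝ) (t₀ : T)
    (hE : Function.Injective (E t₀)) (α β a b : HomeoPlus)
    (hα : ∀ t x, α (E t x) = E t (a x)) (hβ : ∀ t x, β (E t x) = E t (b x))
    (hα' : ∀ z, (∀ t x, E t x ≠ z) → α z = z) (hβ' : ∀ z, (∀ t x, E t x ≠ z) → β z = z) :
    Nonempty (Subgroup.closure {α, β} ≃* Subgroup.closure {a, b}) := by
  apply nonempty_closure_equiv_of_relations
  set φ := FreeGroup.lift fun i : Bool => cond i α β with hφ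
  set ψ := FreeGroup.lift fun i : Bool => cond i a b with hψ
  -- Both properties pass to products and inverses, hence hold for every word. If `ψ w = 1`, then `φ
  -- w` is trivial on and off the images; if `φ w = 1`, injectivity of `E t₀` gives `ψ w = 1`.
  have key : ∀ w : FreeGroup Bool, (∀ t x, φ w (E t x) = E t (ψ w x)) ∧
      ∀ z, (∀ t x, E t x ≠ z) → φ w z = z := by
    intro w
    induction w using FreeGroup.induction_on with
    | C1 => simp
    | of i => cases i <;> simp [hφ, hψ] <;> tauto
    | inv_of i ih =>
      rw [map_inv, map_inv]
      refine ⟨fun t x => HomeoPlus.inv_apply_eq ?_, fun z hz => HomeoPlus.inv_apply_eq (ih.2 z hz)⟩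
      rw [ih.1, HomeoPlus.apply_inv_apply]
    | mul v w hv hw =>
      rw [map_mul, map_mul]
      refine ⟨fun t x => ?_, fun z hz => ?_⟩
      · simp [hv.1, hw.1]
      · simp [hw.2 z hz, hv.2 z hz]
  intro w
  constructor
  · intro h
    refine HomeoPlus.ext fun x => hE ?_
    rw [← (key w).1, h]
    simp
  · intro h
    refine HomeoPlus.ext fun z => ?_
    by_cases hz : ∃ t x, E t x = z
    · obtain ⟨t, x, rfl⟩ := hz
      rw [(key w).1, h]
      simp
    · push Not at hz
      simpa using (key w).2 z hz

/-! ### A strictly increasing function with a jump at each dyadic rational -/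

/-- The strictly increasing function, with a jump at each dyadic rational, that satisfies
`blow (x + 1) = blow x + 2` and `blow (2 * x) = 3 * blow x` for `0 ≤ x < 1`. -/
noncomputable def blow (x : ℝ) : ℝ := 2 / 3 * ∑' i : ℕ, (⌊2 ^ i * x⌋ : ℝ) * (1 / 3) ^ i

/-- The comparison series behind every bound on `blow`: floors are estimated termwise by `2 ^ i * c
+ d`. The value 3 at `c = 1`, `d = 0` explains the factor 2/3, which makes `blow` gain 2 per unit.
-/
theorem hasSum_blow_const (c d : ℝ) :
    HasSum (fun i : ℕ => ((2 : ℝ) ^ i * c + d) * (1 / 3) ^ i) (3 * c + 3 / 2 * d) := by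
  have h1 := (hasSum_geometric_of_lt_one (r := (2 / 3 : ℝ)) (by norm_num) (by norm_num)).mul_left c
  have h2 := (hasSum_geometric_of_lt_one (r := (1 / 3 : ℝ)) (by norm_num) (by norm_num)).mul_left d
  have e : (fun i : ℕ => ((2 : ℝ) ^ i * c + d) * (1 / 3) ^ i) =
      fun i : ℕ => c * (2 / 3) ^ i + d * (1 / 3) ^ i := by
    ext i
    rw [show (2 / 3 : ℝ) = 2 * (1 / 3) by norm_num, mul_pow]
    ring
  rw [e, show 3 * c + 3 / 2 * d = c * (1 - 2 / 3)⁻¹ + d * (1 - 1 / 3)⁻¹ by norm_num; ring]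
  exact h1.add h2

theorem summable_blow (x : ℝ) : Summable fun i : ℕ => (⌊2 ^ i * x⌋ : ℝ) * (1 / 3) ^ i := by
  refine Summable.of_norm_bounded (hasSum_blow_const |x| 1).summable fun i => ?_
  rw [norm_mul, Real.norm_eq_abs, Real.norm_eq_abs, abs_of_nonneg (by positivity : (0 : ℝ) ≤ (1 / 3) ^ i)]
  gcongr
  have h1 := Int.floor_le (2 ^ i * x)
  have h2 := Int.lt_floor_add_one (2 ^ i * x)
  have h3 : |2 ^ i * x| = 2 ^ i * |x| := by rw [abs_mul, abs_of_nonneg (by positivity)]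
  have h4 := le_abs_self (2 ^ i * x)
  have h5 := neg_abs_le (2 ^ i * x)
  rw [abs_le]
  constructor <;> linarith

theorem blow_mono : Monotone blow := by
  intro x y h
  unfold blow
  gcongr
  · exact summable_blow x
  · exact summable_blow y

theorem blow_add_one (x : ℝ) : blow (x + 1) = blow x + 2 := by
  have h : ∀ i : ℕ, (⌊2 ^ i * (x + 1)⌋ : ℝ) = (⌊2 ^ i * x⌋ : ℝ) + 2 ^ i := by
    intro i
    have : (2 : ℝ) ^ i * (x + 1) = 2 ^ i * x + ((2 ^ i : ℤ) : ℝ) := by push_cast; ring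
    rw [this, Int.floor_add_intCast]
    push_cast
    ring
  have h2 := (summable_blow x).hasSum.add (hasSum_blow_const 1 0)
  have h3 : HasSum (fun i : ℕ => (⌊2 ^ i * (x + 1)⌋ : ℝ) * (1 / 3) ^ i)
      (∑' i : ℕ, (⌊2 ^ i * x⌋ : ℝ) * (1 / 3) ^ i + (3 * 1 + 3 / 2 * 0)) := by
    convert h2 using 2 with i
    rw [h]
    ring
  unfold blow
  rw [h3.tsum_eq]
  ring

/-- Doubling `x` shifts the series by one index; the lost first term is the floor of `x`. -/
theorem blow_two_mul (x : ℝ) : blow (2 * x) = 3 * blow x - 2 * ⌊x⌋ := by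
  unfold blow
  rw [(summable_blow x).tsum_eq_zero_add]
  have : ∀ i : ℕ, (⌊2 ^ (i + 1) * x⌋ : ℝ) * (1 / 3) ^ (i + 1) =
      1 / 3 * ((⌊2 ^ i * (2 * x)⌋ : ℝ) * (1 / 3) ^ i) := by
    intro i
    rw [pow_succ, pow_succ, mul_assoc (2 ^ i : ℝ) 2 x]
    ring
  simp_rw [this, tsum_mul_left]
  simp
  ring

theorem le_blow (x : ℝ) : 2 * x - 1 ≤ blow x := by
  have h := hasSum_le (f := fun i : ℕ => ((2 : ℝ) ^ i * x + -1) * (1 / 3) ^ i) (fun i => ?_)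
    (hasSum_blow_const x (-1)) (summable_blow x).hasSum
  · unfold blow
    linarith
  · have := Int.lt_floor_add_one (2 ^ i * x)
    have h3 : (0 : ℝ) ≤ (1 / 3) ^ i := by positivity
    exact mul_le_mul_of_nonneg_right (by linarith) h3

theorem blow_le (x : ℝ) : blow x ≤ 2 * x := by
  have h := hasSum_le (g := fun i : ℕ => ((2 : ℝ) ^ i * x + 0) * (1 / 3) ^ i) (fun i => ?_)
    (summable_blow x).hasSum (hasSum_blow_const x 0)
  · unfold blow
    linarith
  · have := Int.floor_le (2 ^ i * x)
    have h3 : (0 : ℝ) ≤ (1 / 3) ^ i := by positivity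
    exact mul_le_mul_of_nonneg_right (by linarith) h3

theorem blow_zero : blow 0 = 0 := by simp [blow]

/-- Every floor is at most -1. So `blow` skips `(-1, 0)`, its jump at 0, and this locates the
breakpoints of `tripleFun`. -/
theorem blow_le_neg_one {x : ℝ} (hx : x < 0) : blow x ≤ -1 := by
  have h := hasSum_le (g := fun i : ℕ => ((2 : ℝ) ^ i * 0 + (-1)) * (1 / 3) ^ i) (fun i => ?_)
    (summable_blow x).hasSum (hasSum_blow_const 0 (-1))
  · unfold blow
    linarith
  · have h1 : ⌊2 ^ i * x⌋ < 0 := Int.floor_lt.2 (by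
      push_cast
      exact mul_neg_of_pos_of_neg (by positivity) hx)
    have h2 : (⌊2 ^ i * x⌋ : ℝ) ≤ -1 := by exact_mod_cast Int.le_sub_one_of_lt h1
    have h3 : (0 : ℝ) ≤ (1 / 3) ^ i := by positivity
    exact mul_le_mul_of_nonneg_right (by linarith) h3

theorem neg_one_le_blow_add (x : ℝ) : -1 ≤ blow x + blow (-x) := by
  have h := hasSum_le (f := fun i : ℕ => ((2 : ℝ) ^ i * 0 + (-1)) * (1 / 3) ^ i) (fun i => ?_)
    (hasSum_blow_const 0 (-1)) ((summable_blow x).hasSum.add (summable_blow (-x)).hasSum)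
  · unfold blow
    linarith
  · rw [← add_mul]
    have h1 := Int.lt_floor_add_one (2 ^ i * x)
    have h2 := Int.lt_floor_add_one (2 ^ i * -x)
    have h4 : (-2 : ℤ) < ⌊2 ^ i * x⌋ + ⌊2 ^ i * -x⌋ := by
      have : (-2 : ℝ) < ⌊2 ^ i * x⌋ + ⌊2 ^ i * -x⌋ := by linarith
      exact_mod_cast this
    have h5 : (-1 : ℝ) ≤ ⌊2 ^ i * x⌋ + ⌊2 ^ i * -x⌋ := by exact_mod_cast h4
    have h3 : (0 : ℝ) ≤ (1 / 3) ^ i := by positivity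
    exact mul_le_mul_of_nonneg_right (by linarith) h3

theorem blow_strictMono : StrictMono blow := by
  -- A small gap is doubled until it reaches length 1; `blow_two_mul` carries the strict inequality
  -- back, as the floors are monotone.
  have key : ∀ n : ℕ, ∀ x y : ℝ, 1 ≤ 2 ^ n * (y - x) → blow x < blow y := by
    intro n
    induction n with
    | zero =>
      intro x y h
      have h1 := blow_mono (show x + 1 ≤ y by linarith)
      rw [blow_add_one] at h1
      linarith
    | succ n ih =>
      intro x y h
      have h1 := ih (2 * x) (2 * y) (by rw [pow_succ] at h; linarith)
      rw [blow_two_mul, blow_two_mul] at h1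
      have hxy : x ≤ y := by
        by_contra hc
        have : (2 : ℝ) ^ (n + 1) * (y - x) ≤ 0 :=
          mul_nonpos_of_nonneg_of_nonpos (by positivity) (by linarith)
        linarith
      have h2 : (⌊x⌋ : ℝ) ≤ ⌊y⌋ := by exact_mod_cast Int.floor_mono hxy
      linarith
  intro x y h
  obtain ⟨n, hn⟩ := pow_unbounded_of_one_lt (1 / (y - x)) (one_lt_two (α := ℝ))
  refine key n x y ?_
  rw [div_lt_iff₀ (by linarith)] at hn
  exact hn.le

/-- Quantitative right continuity. Passing from `2 * x` to `x` divides the error by 3, provided that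
the increment does not change the floor of `x`; hence the minimum in the choice of increment. -/
theorem exists_blow_add_le (n : ℕ) : ∀ x : ℝ, ∃ δ > 0, blow (x + δ) ≤ blow x + 2 / 3 ^ n := by
  induction n with
  | zero => exact fun x => ⟨1, one_pos, by rw [blow_add_one]; norm_num⟩
  | succ n ih =>
    intro x
    obtain ⟨δ, hδ, h⟩ := ih (2 * x)
    have h1 := Int.lt_floor_add_one x
    refine ⟨min (δ / 2) ((⌊x⌋ + 1 - x) / 2), by
      simp only [gt_iff_lt, lt_min_iff]; constructor <;> linarith, ?_⟩
    set ε := min (δ / 2) ((⌊x⌋ + 1 - x) / 2)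
    have hε : ε ≤ δ / 2 := min_le_left _ _
    have hε' : ε ≤ (⌊x⌋ + 1 - x) / 2 := min_le_right _ _
    have h2 : ⌊x + ε⌋ ≤ ⌊x⌋ := by
      rw [← Int.lt_add_one_iff, Int.floor_lt]
      push_cast
      linarith
    have h2' : (⌊x + ε⌋ : ℝ) ≤ ⌊x⌋ := by exact_mod_cast h2
    have h3 := blow_mono (show 2 * (x + ε) ≤ 2 * x + δ by linarith)
    rw [blow_two_mul] at h3
    rw [blow_two_mul] at h
    have h4 : (2 : ℝ) / 3 ^ (n + 1) = 2 / 3 ^ n / 3 := by rw [pow_succ]; field_simp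
    rw [h4]
    linarith

theorem exists_blow_add_lt {x y : ℝ} (h : blow x < y) : ∃ δ > 0, blow (x + δ) < y := by
  obtain ⟨n, hn⟩ := exists_pow_lt_of_lt_one (show 0 < (y - blow x) / 2 by linarith)
    (show (1 / 3 : ℝ) < 1 by norm_num)
  obtain ⟨δ, hδ, h1⟩ := exists_blow_add_le n x
  refine ⟨δ, hδ, h1.trans_lt ?_⟩
  have : (2 : ℝ) / 3 ^ n = 2 * (1 / 3) ^ n := by rw [one_div, inv_pow]; ring
  linarith

/-- The left limit of `blow` at `x`. -/
noncomputable def blowLeft (x : ℝ) : ℝ := -1 - blow (-x)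

/-- `blowLeft` replaces each floor `⌊u⌋` in the series by its left limit `-1 - ⌊-u⌋`, so reflection
turns facts about `blow` into facts about `blowLeft`. -/
theorem blowLeft_le (x : ℝ) : blowLeft x ≤ blow x := by
  have := neg_one_le_blow_add x
  unfold blowLeft
  linarith

theorem blowLeft_mono : Monotone blowLeft := by
  intro x y h
  have := blow_mono (neg_le_neg h)
  unfold blowLeft
  linarith

theorem blowLeft_add_one (x : ℝ) : blowLeft (x + 1) = blowLeft x + 2 := by
  have := blow_add_one (-(x + 1))
  rw [show -(x + 1) + 1 = -x by ring] at this
  unfold blowLeft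
  linarith

theorem exists_mem_jump (y : ℝ) : ∃ x, blowLeft x ≤ y ∧ y ≤ blow x := by
  set S := {z | blow z ≤ y}
  have hne : S.Nonempty := ⟨y / 2, (blow_le _).trans (by linarith)⟩
  have hb : BddAbove S := ⟨(y + 1) / 2, fun z hz => by
    have := le_blow z
    have hz' : blow z ≤ y := hz
    linarith⟩
  refine ⟨sSup S, ?_, ?_⟩
  · by_contra hc
    -- Right continuity at the reflected point shows that `blow` already exceeds `y` slightly to the
    -- left of the supremum.
    have h1 : blow (-sSup S) < -1 - y := by
      unfold blowLeft at hc
      linarith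
    obtain ⟨δ, hδ, h2⟩ := exists_blow_add_lt h1
    obtain ⟨z, hz, hlt⟩ := exists_lt_of_lt_csSup hne (show sSup S - δ < sSup S by linarith)
    have h3 := blow_mono hlt.le
    have h4 := blowLeft_le (sSup S - δ)
    unfold blowLeft at h4
    rw [show -(sSup S - δ) = -sSup S + δ by ring] at h4
    have hz' : blow z ≤ y := hz
    linarith
  · by_contra hc
    obtain ⟨δ, hδ, h2⟩ := exists_blow_add_lt (not_le.1 hc)
    have := le_csSup hb (show sSup S + δ ∈ S from h2.le)
    linarith

/-- The parametrization, by `t ∈ [0, 1]`, of the jump of `blow` at `x`. -/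
noncomputable def jump (t : Set.Icc (0 : ℝ) 1) (x : ℝ) : ℝ := (1 - t) * blowLeft x + t * blow x

theorem blowLeft_le_jump (t : Set.Icc (0 : ℝ) 1) (x : ℝ) : blowLeft x ≤ jump t x := by
  have := mul_le_mul_of_nonneg_left (blowLeft_le x) t.2.1
  unfold jump
  linarith

theorem jump_le_blow (t : Set.Icc (0 : ℝ) 1) (x : ℝ) : jump t x ≤ blow x := by
  have := mul_le_mul_of_nonneg_left (blowLeft_le x) (sub_nonneg.2 t.2.2)
  unfold jump
  linarith

theorem jump_surjective (y : ℝ) : ∃ t x, jump t x = y := by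
  obtain ⟨x, h1, h2⟩ := exists_mem_jump y
  have h : y ∈ segment ℝ (blowLeft x) (blow x) := by
    rw [segment_eq_Icc (blowLeft_le x)]
    exact ⟨h1, h2⟩
  obtain ⟨s, t, hs, ht, hst, rfl⟩ := h
  refine ⟨⟨t, ht, by linarith⟩, x, ?_⟩
  obtain rfl : s = 1 - t := by linarith
  simp [jump]

theorem jump_one : jump ⟨1, by simp⟩ = blow := by
  ext x
  simp [jump]

theorem jump_add_one (t : Set.Icc (0 : ℝ) 1) (x : ℝ) : jump t (x + 1) = jump t x + 2 := by
  unfold jump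
  rw [blow_add_one, blowLeft_add_one]
  ring

/-- Strictness at 0 matters: it makes the floor of `-x` equal to -1, so both ends of the jump scale
by 3. -/
theorem jump_two_mul (t : Set.Icc (0 : ℝ) 1) {x : ℝ} (h0 : 0 < x) (h1 : x < 1) :
    jump t (2 * x) = 3 * jump t x := by
  have e1 : ⌊x⌋ = 0 := Int.floor_eq_zero_iff.2 ⟨h0.le, h1⟩
  have e2 : ⌊-x⌋ = -1 := by
    rw [Int.floor_eq_iff]
    push_cast
    constructor <;> linarith
  unfold jump blowLeft
  rw [show -(2 * x) = 2 * -x by ring, blow_two_mul, blow_two_mul, e1, e2]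
  push_cast
  ring

/-- The blown up form of `thompsonBFun`. -/
noncomputable def tripleFun (y : ℝ) : ℝ := if y ≤ 0 then y else if y ≤ 1 then 3 * y else y + 2

theorem tripleFun_jump (t : Set.Icc (0 : ℝ) 1) (x : ℝ) :
    tripleFun (jump t x) = jump t (thompsonBFun x) := by
  have hl := blowLeft_le_jump t x
  have hr := jump_le_blow t x
  unfold thompsonBFun
  split_ifs with h1 h2
  · have := blow_mono h1
    rw [blow_zero] at this
    rw [tripleFun, if_pos (by linarith)]
  · push Not at h1
    rw [jump_two_mul t h1 h2]
    have h3 := blow_le_neg_one (neg_lt_zero.2 h1)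
    have h4 := blow_le_neg_one (sub_neg.2 h2)
    have h5 := blow_add_one (x - 1)
    rw [sub_add_cancel] at h5
    unfold blowLeft at hl
    unfold tripleFun
    split_ifs <;> linarith
  · push Not at h2
    rw [jump_add_one]
    have h3 := blowLeft_mono h2
    have h4 : blowLeft 1 = 1 := by
      have := blowLeft_add_one 0
      rw [zero_add] at this
      rw [this, blowLeft, neg_zero, blow_zero]
      norm_num
    unfold tripleFun
    split_ifs <;> linarith

/-! ### Order embeddings of the line onto bounded intervals -/

/-- The increasing bijection of `ℝ` onto the positive reals that is the identity on `[1, ∞)` and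
satisfies `halfEmb (s - 2) = halfEmb s / 3` for `s ≤ 3`. -/
noncomputable def halfEmb (s : ℝ) : ℝ := (s + 2 * ⌊(3 - s) / 2⌋₊) / 3 ^ ⌊(3 - s) / 2⌋₊

/-- For `s ≤ 3`, the natural floor counts the steps of length 2 that bring `s` into `(1, 3]`; one
step further back costs one more division by 3. -/
theorem halfEmb_sub_two {s : ℝ} (hs : s ≤ 3) : halfEmb (s - 2) = halfEmb s / 3 := by
  have h : ⌊(3 - (s - 2)) / 2⌋₊ = ⌊(3 - s) / 2⌋₊ + 1 := by
    rw [← Nat.floor_add_one (by linarith)]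
    congr 1
    ring
  unfold halfEmb
  rw [h, pow_succ]
  push_cast
  field_simp
  ring

theorem halfEmb_add_two {s : ℝ} (hs : s ≤ 1) : halfEmb (s + 2) = 3 * halfEmb s := by
  have := halfEmb_sub_two (show s + 2 ≤ 3 by linarith)
  rw [add_sub_cancel_right] at this
  linarith

theorem halfEmb_of_one_le {s : ℝ} (hs : 1 ≤ s) : halfEmb s = s := by
  have key : ∀ s : ℝ, 1 < s → halfEmb s = s := by
    intro s hs
    have h : ⌊(3 - s) / 2⌋₊ = 0 := Nat.floor_eq_zero.2 (by linarith)
    simp [halfEmb, h]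
  rcases hs.eq_or_lt with rfl | h
  · have := halfEmb_add_two (le_refl 1)
    rw [key _ (by norm_num)] at this
    linarith
  · exact key s h

theorem halfEmb_strictMono : StrictMono halfEmb := by
  have key : ∀ n : ℕ, ∀ s s' : ℝ, 1 - 2 * n < s → s < s' → halfEmb s < halfEmb s' := by
    intro n
    induction n with
    | zero =>
      intro s s' h h'
      norm_num at h
      rwa [halfEmb_of_one_le h.le, halfEmb_of_one_le (h.trans h').le]
    | succ n ih =>
      intro s s' h h'
      push_cast at h
      rcases lt_or_ge 1 s with h1 | h1
      · rwa [halfEmb_of_one_le h1.le, halfEmb_of_one_le (h1.trans h').le]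
      rcases lt_or_ge 1 s' with h2 | h2
      · rcases h1.eq_or_lt with rfl | h1
        · rwa [halfEmb_of_one_le le_rfl, halfEmb_of_one_le h2.le]
        · have := ih (s + 2) 3 (by linarith) (by linarith)
          rw [halfEmb_add_two h1.le, halfEmb_of_one_le (by norm_num : (1 : ℝ) ≤ 3)] at this
          rw [halfEmb_of_one_le h2.le]
          linarith
      · have := ih (s + 2) (s' + 2) (by linarith) (by linarith)
        rw [halfEmb_add_two h1, halfEmb_add_two h2] at this
        linarith
  intro s s' h
  obtain ⟨n, hn⟩ := exists_nat_gt (1 - s)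
  exact key n s s' (by have : (0 : ℝ) ≤ n := n.cast_nonneg; linarith) h

theorem halfEmb_pos (s : ℝ) : 0 < halfEmb s := by
  unfold halfEmb
  have h := Nat.lt_floor_add_one ((3 - s) / 2)
  have : 0 < s + 2 * (⌊(3 - s) / 2⌋₊ : ℝ) := by
    linarith
  positivity

theorem exists_halfEmb_eq {y : ℝ} (hy : 0 < y) : ∃ s, halfEmb s = y := by
  have key : ∀ n : ℕ, ∀ y : ℝ, 1 ≤ 3 ^ n * y → ∃ s, halfEmb s = y := by
    intro n
    induction n with
    | zero => exact fun y h => ⟨y, halfEmb_of_one_le (by simpa using h)⟩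
    | succ n ih =>
      intro y h
      rcases le_total 1 y with h1 | h1
      · exact ⟨y, halfEmb_of_one_le h1⟩
      obtain ⟨s, hs⟩ := ih (3 * y) (by rw [pow_succ] at h; linarith)
      have h3 : s ≤ 3 := by
        rw [← halfEmb_strictMono.le_iff_le, hs, halfEmb_of_one_le (by norm_num : (1 : ℝ) ≤ 3)]
        linarith
      exact ⟨s - 2, by rw [halfEmb_sub_two h3, hs]; ring⟩
  obtain ⟨n, hn⟩ := pow_unbounded_of_one_lt (1 / y) (by norm_num : (1 : ℝ) < 3)
  rw [div_lt_iff₀ hy] at hn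
  exact key n y hn.le

/-- An increasing bijection of `ℝ` onto `(0, c)` that is the identity on `[1, c - 1]`. -/
noncomputable def emb (c y : ℝ) : ℝ := if y ≤ 3 then halfEmb y else c - halfEmb (c - y)

theorem emb_of_le {c y : ℝ} (h : y ≤ c - 1) : emb c y = halfEmb y := by
  unfold emb
  split_ifs with h1
  · rfl
  · rw [halfEmb_of_one_le (by linarith), halfEmb_of_one_le (by linarith)]
    ring

/-- With `4 ≤ c` both formulas are the identity on `[1, 3]`, so the cut at 3 could be made at 1. -/
theorem emb_of_ge {c y : ℝ} (hc : 4 ≤ c) (h : 1 ≤ y) : emb c y = c - halfEmb (c - y) := by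
  unfold emb
  split_ifs with h1
  · rw [halfEmb_of_one_le (by linarith), halfEmb_of_one_le (by linarith)]
    ring
  · rfl

theorem emb_of_mem {c y : ℝ} (h1 : 1 ≤ y) (h2 : y ≤ c - 1) : emb c y = y := by
  rw [emb_of_le h2, halfEmb_of_one_le h1]

theorem emb_strictMono {c : ℝ} (hc : 4 ≤ c) : StrictMono (emb c) := by
  intro x y h
  rcases le_or_gt y (c - 1) with h1 | h1
  · rw [emb_of_le h1, emb_of_le (by linarith)]
    exact halfEmb_strictMono h
  rcases le_or_gt 1 x with h2 | h2
  · rw [emb_of_ge hc h2, emb_of_ge hc (by linarith)]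
    have := halfEmb_strictMono (show c - y < c - x by linarith)
    linarith
  · rw [emb_of_ge (y := y) hc (by linarith), emb_of_le (y := x) (by linarith)]
    have h3 := halfEmb_strictMono h2
    have h4 := halfEmb_strictMono (show c - y < 1 by linarith)
    rw [halfEmb_of_one_le le_rfl] at h3 h4
    linarith

theorem emb_mem {c : ℝ} (hc : 4 ≤ c) (y : ℝ) : emb c y ∈ Set.Ioo 0 c := by
  unfold emb
  have h0 := halfEmb_pos y
  have h0' := halfEmb_pos (c - y)
  split_ifs with h1
  · have := halfEmb_strictMono.monotone h1
    rw [halfEmb_of_one_le (by norm_num : (1 : ℝ) ≤ 3)] at this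
    exact ⟨h0, by linarith⟩
  · have := halfEmb_strictMono (show c - y < c - 3 by linarith)
    rw [halfEmb_of_one_le (by linarith : 1 ≤ c - 3)] at this
    exact ⟨by linarith, by linarith⟩

theorem exists_emb_eq {c : ℝ} (hc : 4 ≤ c) {x : ℝ} (hx : x ∈ Set.Ioo 0 c) : ∃ y, emb c y = x := by
  rcases le_or_gt x 3 with h | h
  · obtain ⟨y, rfl⟩ := exists_halfEmb_eq hx.1
    refine ⟨y, emb_of_le ?_⟩
    have : y ≤ 3 := by
      rwa [← halfEmb_strictMono.le_iff_le, halfEmb_of_one_le (by norm_num : (1 : ℝ) ≤ 3)]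
    linarith
  · obtain ⟨s, hs⟩ := exists_halfEmb_eq (sub_pos.2 hx.2)
    refine ⟨c - s, ?_⟩
    have : s < c - 3 := by
      rw [← halfEmb_strictMono.lt_iff_lt, halfEmb_of_one_le (by linarith : 1 ≤ c - 3)]
      linarith
    rw [emb_of_ge hc (by linarith), sub_sub_cancel, hs]
    ring

/-! ### The basic bump -/

/-- A piecewise linear map with support `(0, 7)`, conjugate there to a translation. -/
noncomputable def bumpFun (x : ℝ) : ℝ :=
  if x ≤ 0 then x else if x ≤ 1 then 3 * x else if x ≤ 4 then x + 2
  else if x ≤ 7 then x / 3 + 14 / 3 else x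

theorem bumpFun_strictMono : StrictMono bumpFun := by
  intro x y h
  unfold bumpFun
  split_ifs <;> linarith

theorem bumpFun_surjective : Function.Surjective bumpFun := by
  intro y
  rcases le_or_gt y 0 with h | h
  · exact ⟨y, by simp [bumpFun, h]⟩
  rcases le_or_gt y 3 with h1 | h1
  · refine ⟨y / 3, ?_⟩
    unfold bumpFun
    split_ifs <;> linarith
  rcases le_or_gt y 6 with h2 | h2
  · refine ⟨y - 2, ?_⟩
    unfold bumpFun
    split_ifs <;> linarith
  rcases le_or_gt y 7 with h3 | h3
  · refine ⟨3 * y - 14, ?_⟩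
    unfold bumpFun
    split_ifs <;> linarith
  · refine ⟨y, ?_⟩
    unfold bumpFun
    split_ifs <;> linarith

theorem le_bumpFun (x : ℝ) : x ≤ bumpFun x := by
  unfold bumpFun
  split_ifs <;> linarith

theorem bumpFun_ne_iff (x : ℝ) : bumpFun x ≠ x ↔ x ∈ Set.Ioo 0 7 := by
  rw [Set.mem_Ioo]
  unfold bumpFun
  split_ifs
  · constructor
    · intro h; exact absurd rfl h
    · rintro ⟨_, _⟩; linarith
  · constructor
    · intro; constructor <;> linarith
    · intro _ _; linarith
  · constructor
    · intro; constructor <;> linarith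
    · intro _ _; linarith
  · rename_i h1 h2 h3 h4
    constructor
    · intro h
      refine ⟨by linarith, lt_of_le_of_ne h4 ?_⟩
      rintro rfl
      norm_num at h
    · rintro ⟨_, _⟩ _; linarith
  · constructor
    · intro h; exact absurd rfl h
    · rintro ⟨_, _⟩; linarith

theorem bumpFun_emb (y : ℝ) : bumpFun (emb 7 y) = emb 7 (y + 2) := by
  rcases le_or_gt y 1 with h | h
  · rw [emb_of_le (by linarith), emb_of_le (by linarith), halfEmb_add_two h]
    have h1 := halfEmb_pos y
    have h2 := halfEmb_strictMono.monotone h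
    rw [halfEmb_of_one_le le_rfl] at h2
    unfold bumpFun
    split_ifs <;> linarith
  rcases le_or_gt y 4 with h1 | h1
  · rw [emb_of_mem h.le (by linarith), emb_of_mem (by linarith) (by linarith)]
    unfold bumpFun
    split_ifs <;> linarith
  · rw [emb_of_ge (by norm_num) h.le, emb_of_ge (by norm_num) (by linarith),
      show 7 - (y + 2) = 7 - y - 2 by ring, halfEmb_sub_two (by linarith)]
    have h2 := halfEmb_pos (7 - y)
    have h3 := halfEmb_strictMono.monotone (show 7 - y ≤ 3 by linarith)
    rw [halfEmb_of_one_le (by norm_num : (1 : ℝ) ≤ 3)] at h3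
    unfold bumpFun
    split_ifs <;> linarith

/-- The conjugate of the basic bump by the translation by `c`, with support `(c, c + 7)`. -/
noncomputable def bumpAt (c : ℝ) : HomeoPlus :=
  HomeoPlus.translate c * HomeoPlus.mk' bumpFun bumpFun_strictMono bumpFun_surjective *
    (HomeoPlus.translate c)⁻¹

@[simp] theorem bumpAt_apply (c x : ℝ) : bumpAt c x = bumpFun (x - c) + c := by
  rw [← HomeoPlus.translate_inv_apply]
  rfl

theorem supp_bumpAt (c : ℝ) : supp (bumpAt c) = Set.Ioo c (c + 7) := by
  ext x
  change bumpAt c x ≠ x ↔ _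
  have h := bumpFun_ne_iff (x - c)
  rw [bumpAt_apply, Ne, ← eq_sub_iff_add_eq, ← Ne, h, Set.mem_Ioo, Set.mem_Ioo]
  constructor <;> rintro ⟨_, _⟩ <;> constructor <;> linarith

theorem bumpAt_translate (c d : ℝ) :
    bumpAt (d + c) = HomeoPlus.translate d * bumpAt c * (HomeoPlus.translate d)⁻¹ := by
  refine HomeoPlus.ext fun x => ?_
  simp only [HomeoPlus.mul_apply, bumpAt_apply, HomeoPlus.translate_apply,
    HomeoPlus.translate_inv_apply]
  rw [sub_sub]
  ring

/-! ### Two overlapping bumps generate Thompson's group -/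

theorem bumpFun_emb_triple (y : ℝ) :
    bumpFun (emb 11 (y + 4) - 4) + 4 = emb 11 (tripleFun y + 4) := by
  have mono := (emb_strictMono (c := 11) (by norm_num)).monotone
  unfold tripleFun
  split_ifs with h0 h1
  · have h2 := mono (show y + 4 ≤ 4 by linarith)
    rw [emb_of_mem (y := 4) (by norm_num) (by norm_num)] at h2
    rw [bumpFun, if_pos (by linarith)]
    ring
  · rw [emb_of_mem (by linarith) (by linarith), emb_of_mem (by linarith) (by linarith)]
    unfold bumpFun
    split_ifs <;> linarith
  rcases le_or_gt y 4 with h2 | h2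
  · rw [emb_of_mem (by linarith) (by linarith), emb_of_mem (by linarith) (by linarith)]
    unfold bumpFun
    split_ifs <;> linarith
  · rw [emb_of_ge (by norm_num) (by linarith), emb_of_ge (by norm_num) (by linarith),
      show 11 - (y + 2 + 4) = 11 - (y + 4) - 2 by ring, halfEmb_sub_two (by linarith)]
    have h2 := halfEmb_pos (11 - (y + 4))
    have h3 := halfEmb_strictMono.monotone (show 11 - (y + 4) ≤ 3 by linarith)
    rw [halfEmb_of_one_le (by norm_num : (1 : ℝ) ≤ 3)] at h3
    unfold bumpFun
    split_ifs <;> linarith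

/-- Together with `bumpFun_emb_triple`: in the coordinate `emb 11 (y + 4)` on `(0, 11)`, `bumpAt 4`
is `tripleFun` and `bumpAt 0 * bumpAt 4` is translation by 2, the blown up forms of `b` and `a`. -/
theorem bumpFun_emb_tripleFun (y : ℝ) :
    bumpFun (emb 11 (tripleFun y + 4)) = emb 11 (y + 2 + 4) := by
  have mono := (emb_strictMono (c := 11) (by norm_num)).monotone
  unfold tripleFun
  split_ifs with h0 h1
  · rcases le_or_gt y (-3) with h | h
    · rw [emb_of_le (by linarith), emb_of_le (by linarith),
        show y + 2 + 4 = y + 4 + 2 by ring, halfEmb_add_two (by linarith)]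
      have h1 := halfEmb_pos (y + 4)
      have h2 := halfEmb_strictMono.monotone (show y + 4 ≤ 1 by linarith)
      rw [halfEmb_of_one_le le_rfl] at h2
      unfold bumpFun
      split_ifs <;> linarith
    · rw [emb_of_mem (by linarith) (by linarith), emb_of_mem (by linarith) (by linarith)]
      unfold bumpFun
      split_ifs <;> linarith
  · rw [emb_of_mem (by linarith) (by linarith), emb_of_mem (by linarith) (by linarith)]
    unfold bumpFun
    split_ifs <;> linarith
  · have h2 := mono (show 7 ≤ y + 2 + 4 by linarith)
    rw [emb_of_mem (y := 7) (by norm_num) (by norm_num)] at h2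
    unfold bumpFun
    split_ifs <;> linarith

theorem nonempty_closure_bumpAt_zero_four_equiv :
    Nonempty (Subgroup.closure {bumpAt 0, bumpAt 4} ≃* ThompsonF) := by
  rw [← closure_pair_mul_left]
  have hout : ∀ z : ℝ, (∀ (t : Set.Icc (0 : ℝ) 1) (x : ℝ), emb 11 (jump t x + 4) ≠ z) →
      bumpAt 0 z = z ∧ bumpAt 4 z = z := by
    intro z hz
    have h : z ∉ Set.Ioo 0 11 := by
      intro h
      obtain ⟨y, rfl⟩ := exists_emb_eq (by norm_num) h
      obtain ⟨t, x, htx⟩ := jump_surjective (y - 4)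
      exact hz t x (by rw [htx, sub_add_cancel])
    have h0 : z ∉ supp (bumpAt 0) := by
      rw [supp_bumpAt]
      exact fun h' => h ⟨by linarith [h'.1], by linarith [h'.2]⟩
    have h4 : z ∉ supp (bumpAt 4) := by
      rw [supp_bumpAt]
      exact fun h' => h ⟨by linarith [h'.1], by linarith [h'.2]⟩
    exact ⟨not_not.1 h0, not_not.1 h4⟩
  refine nonempty_closure_equiv_of_intertwine (fun (t : Set.Icc (0 : ℝ) 1) x =>
    emb 11 (jump t x + 4)) ⟨1, by simp⟩ ?_ _ _ _ _ ?_ ?_ ?_ ?_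
  · simp only [jump_one]
    exact fun x y h => blow_strictMono.injective
      (add_right_cancel ((emb_strictMono (by norm_num)).injective h))
  · intro t x
    simp only [HomeoPlus.mul_apply, bumpAt_apply, thompsonA_apply, sub_zero, add_zero,
      bumpFun_emb_triple, bumpFun_emb_tripleFun, jump_add_one]
  · intro t x
    simp only [bumpAt_apply, thompsonB_apply, bumpFun_emb_triple, tripleFun_jump]
  · intro z hz
    rw [HomeoPlus.mul_apply, (hout z hz).2, (hout z hz).1]
  · exact fun z hz => (hout z hz).2

theorem nonempty_closure_bumpAt_equiv (c : ℝ) :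
    Nonempty (Subgroup.closure {bumpAt c, bumpAt (c + 4)} ≃* ThompsonF) := by
  have h := nonempty_closure_conj_equiv (HomeoPlus.translate c) (bumpAt 0) (bumpAt 4)
  rw [← bumpAt_translate, ← bumpAt_translate, add_zero] at h
  exact ⟨h.some.trans nonempty_closure_bumpAt_zero_four_equiv.some⟩

/-! ### An invariant Cantor set -/

/-- The union of the translates of the ternary Cantor set by the even integers. -/
def cells : Set ℝ := {x | ∃ k : ℤ, x - 2 * k ∈ cantorSet}

theorem add_two_mul_mem_cells_iff (x : ℝ) (n : ℤ) : x + 2 * n ∈ cells ↔ x ∈ cells := by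
  constructor
  · rintro ⟨k, hk⟩
    refine ⟨k - n, ?_⟩
    convert hk using 1
    push_cast
    ring
  · rintro ⟨k, hk⟩
    refine ⟨k + n, ?_⟩
    convert hk using 1
    push_cast
    ring

theorem add_two_mem_cells_iff (x : ℝ) : x + 2 ∈ cells ↔ x ∈ cells := by
  simpa using add_two_mul_mem_cells_iff x 1

theorem zero_mem_cells : (0 : ℝ) ∈ cells := ⟨0, by simpa using zero_mem_cantorSet⟩

theorem le_three_of_mem_cells {x : ℝ} (hx : x ∈ cells) (h4 : x < 4) : x ≤ 3 := by
  obtain ⟨k, hk⟩ := hx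
  have h := cantorSet_subset_unitInterval hk
  have h1 : k < 2 := by
    have : (k : ℝ) < 2 := by linarith [h.1]
    exact_mod_cast this
  have h1' : (k : ℝ) ≤ 1 := by exact_mod_cast Int.le_sub_one_of_lt h1
  linarith [h.2]

/-- On `[0, 3]`, `cells` consists of the Cantor set and its translate by 2; dividing by 3 gives the
two halves of the Cantor set. -/
theorem div_three_mem_cells_iff {x : ℝ} (h0 : 0 ≤ x) (h3 : x ≤ 3) :
    x / 3 ∈ cells ↔ x ∈ cells := by
  constructor
  · rintro ⟨k, hk⟩
    have h := cantorSet_subset_unitInterval hk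
    have h1 : -1 < k := by
      have : (-1 : ℝ) < k := by linarith [h.2]
      exact_mod_cast this
    have h2 : k < 1 := by
      have : (k : ℝ) < 1 := by linarith [h.1]
      exact_mod_cast this
    obtain rfl : k = 0 := by omega
    rw [cantorSet_eq_union_halves] at hk
    rcases hk with ⟨c, hc, hcx⟩ | ⟨c, hc, hcx⟩
    · refine ⟨0, ?_⟩
      obtain rfl : c = x := by simpa using hcx
      simpa using hc
    · refine ⟨1, ?_⟩
      have : x - 2 * (1 : ℤ) = c := by
        simp only [Int.cast_zero, mul_zero, sub_zero] at hcx
        push_cast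
        linarith
      rwa [this]
  · rintro ⟨k, hk⟩
    have h := cantorSet_subset_unitInterval hk
    have h1 : -1 < k := by
      have : (-1 : ℝ) < k := by linarith [h.2]
      exact_mod_cast this
    have h2 : k < 2 := by
      have : (k : ℝ) < 2 := by linarith [h.1]
      exact_mod_cast this
    refine ⟨0, ?_⟩
    rw [cantorSet_eq_union_halves]
    obtain rfl | rfl : k = 0 ∨ k = 1 := by omega
    · exact Or.inl ⟨x, by simpa using hk, by simp⟩
    · exact Or.inr ⟨_, hk, by push_cast; ring⟩

theorem bumpFun_mem_cells_iff (x : ℝ) : bumpFun x ∈ cells ↔ x ∈ cells := by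
  unfold bumpFun
  split_ifs with h0 h1 h4 h7
  · rfl
  · have := div_three_mem_cells_iff (x := 3 * x) (by linarith) (by linarith)
    rw [← this]
    congr! 1
    ring
  · exact add_two_mem_cells_iff x
  -- Translating by -4 before and by -6 after turns this piece into division by 3 on `[0, 3]`.
  · rw [← add_two_mul_mem_cells_iff x (-2), ← add_two_mul_mem_cells_iff _ (-3),
      ← div_three_mem_cells_iff (x := x + 2 * (-2 : ℤ)) (by push_cast; linarith)
        (by push_cast; linarith)]
    congr! 1
    push_cast
    ring
  · rfl

theorem bumpAt_mem_cells_iff (m : ℤ) (x : ℝ) : bumpAt (4 * m) x ∈ cells ↔ x ∈ cells := by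
  have h1 := add_two_mul_mem_cells_iff (bumpFun (x - 4 * m)) (2 * m)
  have h2 := add_two_mul_mem_cells_iff x (-2 * m)
  rw [bumpAt_apply]
  rw [bumpFun_mem_cells_iff] at h1
  push_cast at h1 h2
  rw [show x + 2 * (-2 * (m : ℝ)) = x - 4 * m by ring] at h2
  rw [show (4 : ℝ) * m = 2 * (2 * m) by ring] at h2 ⊢
  rw [show (4 : ℝ) * m = 2 * (2 * m) by ring] at h1
  rw [h1, h2]

/-! ### A homeomorphism commuting with the basic bump -/

/-- A homeomorphism of the line with support `(1, 2)`. -/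
noncomputable def nudge (s : ℝ) : ℝ := max s (min (2 * s - 1) (s / 2 + 1))

theorem nudge_strictMono : StrictMono nudge := by
  intro x y h
  exact max_lt_max h (min_lt_min (by linarith) (by linarith))

theorem nudge_of_le {s : ℝ} (h : s ≤ 1) : nudge s = s :=
  max_eq_left ((min_le_left _ _).trans (by linarith))

theorem nudge_of_ge {s : ℝ} (h : 2 ≤ s) : nudge s = s :=
  max_eq_left ((min_le_right _ _).trans (by linarith))

theorem exists_nudge_eq (z : ℝ) : ∃ s, nudge s = z := by
  have hc : Continuous nudge := by unfold nudge; fun_prop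
  have h := intermediate_value_Icc (show min z 1 ≤ max z 2 from (min_le_left _ _).trans
    (le_max_left _ _)) hc.continuousOn
  rw [nudge_of_le (min_le_right _ _), nudge_of_ge (le_max_right _ _)] at h
  obtain ⟨s, -, hs⟩ := h ⟨min_le_left _ _, le_max_left _ _⟩
  exact ⟨s, hs⟩

/-- The homeomorphism that agrees with `nudge` on `[0, 2]` and commutes with `y ↦ y + 2`. -/
noncomputable def twistFun (y : ℝ) : ℝ := 2 * ⌊y / 2⌋ + nudge (y - 2 * ⌊y / 2⌋)

theorem twistFun_of_mem {y : ℝ} (k : ℤ) (h0 : 2 * k ≤ y) (h2 : y < 2 * k + 2) :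
    twistFun y = 2 * k + nudge (y - 2 * k) := by
  have : ⌊y / 2⌋ = k := by
    rw [Int.floor_eq_iff]
    constructor <;> linarith
  rw [twistFun, this]

theorem twistFun_add_two (y : ℝ) : twistFun (y + 2) = twistFun y + 2 := by
  have h : ⌊(y + 2) / 2⌋ = ⌊y / 2⌋ + 1 := by
    rw [← Int.floor_add_one]
    congr 1
    ring
  unfold twistFun
  rw [h]
  push_cast
  rw [show y + 2 - 2 * ((⌊y / 2⌋ : ℝ) + 1) = y - 2 * ⌊y / 2⌋ by ring]
  ring

theorem twistFun_mem (y : ℝ) : 2 * (⌊y / 2⌋ : ℝ) ≤ twistFun y ∧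
    twistFun y < 2 * (⌊y / 2⌋ : ℝ) + 2 := by
  have h1 := Int.floor_le (y / 2)
  have h2 := Int.lt_floor_add_one (y / 2)
  have h3 := nudge_strictMono.monotone (show 0 ≤ y - 2 * ⌊y / 2⌋ by linarith)
  have h4 := nudge_strictMono (show y - 2 * ⌊y / 2⌋ < 2 by linarith)
  rw [nudge_of_le (by norm_num)] at h3
  rw [nudge_of_ge le_rfl] at h4
  unfold twistFun
  constructor <;> linarith

theorem twistFun_strictMono : StrictMono twistFun := by
  intro x y h
  have h1 : ⌊x / 2⌋ ≤ ⌊y / 2⌋ := Int.floor_mono (by linarith)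
  rcases h1.eq_or_lt with h1 | h1
  · unfold twistFun
    rw [h1]
    have := nudge_strictMono (show x - 2 * ⌊y / 2⌋ < y - 2 * ⌊y / 2⌋ by linarith)
    linarith
  · have h2 : (⌊x / 2⌋ : ℝ) + 1 ≤ ⌊y / 2⌋ := by exact_mod_cast h1
    linarith [(twistFun_mem x).2, (twistFun_mem y).1]

theorem twistFun_surjective : Function.Surjective twistFun := by
  intro z
  obtain ⟨s, hs⟩ := exists_nudge_eq (z - 2 * ⌊z / 2⌋)
  have h1 := Int.floor_le (z / 2)
  have h2 := Int.lt_floor_add_one (z / 2)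
  have h3 : 0 ≤ s := by
    rw [← nudge_strictMono.le_iff_le, nudge_of_le zero_le_one, hs]
    linarith
  have h4 : s < 2 := by
    rw [← nudge_strictMono.lt_iff_lt, nudge_of_ge le_rfl, hs]
    linarith
  refine ⟨2 * ⌊z / 2⌋ + s, ?_⟩
  rw [twistFun_of_mem ⌊z / 2⌋ (by linarith) (by linarith), add_sub_cancel_left, hs]
  ring

/-- A homeomorphism of `(0, c)` may be extended by the identity. -/
theorem exists_extend_emb {c : ℝ} (hc : 4 ≤ c) (η : ℝ → ℝ) (hm : StrictMono η)
    (hs : Function.Surjective η) :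
    ∃ h : HomeoPlus, (∀ y, h (emb c y) = emb c (η y)) ∧ ∀ x ∉ Set.Ioo 0 c, h x = x := by
  classical
  set F : ℝ → ℝ := fun x =>
    if hx : x ∈ Set.Ioo 0 c then emb c (η (exists_emb_eq hc hx).choose) else x with hF
  have h1 : ∀ y, F (emb c y) = emb c (η y) := by
    intro y
    have hy := emb_mem hc y
    rw [hF]
    simp only [hy, dif_pos]
    rw [(emb_strictMono hc).injective (exists_emb_eq hc hy).choose_spec]
  have h2 : ∀ x ∉ Set.Ioo 0 c, F x = x := fun x hx => dif_neg hx
  refine ⟨HomeoPlus.mk' F ?_ ?_, h1, h2⟩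
  · intro x y hxy
    by_cases hx : x ∈ Set.Ioo 0 c <;> by_cases hy : y ∈ Set.Ioo 0 c
    · obtain ⟨x, rfl⟩ := exists_emb_eq hc hx
      obtain ⟨y, rfl⟩ := exists_emb_eq hc hy
      rw [h1, h1]
      exact emb_strictMono hc (hm ((emb_strictMono hc).lt_iff_lt.1 hxy))
    · have hy' : c ≤ y := by
        by_contra hlt
        exact hy ⟨hx.1.trans hxy, not_le.1 hlt⟩
      obtain ⟨x, rfl⟩ := exists_emb_eq hc hx
      rw [h1, h2 y hy]
      exact (emb_mem hc _).2.trans_le hy'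
    · have hx' : x ≤ 0 := by
        by_contra hlt
        exact hx ⟨not_le.1 hlt, hxy.trans hy.2⟩
      obtain ⟨y, rfl⟩ := exists_emb_eq hc hy
      rw [h1, h2 x hx]
      exact hx'.trans_lt (emb_mem hc _).1
    · rwa [h2 x hx, h2 y hy]
  · intro z
    by_cases hz : z ∈ Set.Ioo 0 c
    · obtain ⟨y, rfl⟩ := exists_emb_eq hc hz
      obtain ⟨x, rfl⟩ := hs y
      exact ⟨emb c x, h1 x⟩
    · exact ⟨z, h2 z hz⟩

theorem emb_mem_cells_iff (y : ℝ) (n : ℤ) : emb 7 (y + 2 * n) ∈ cells ↔ emb 7 y ∈ cells := by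
  have step : ∀ y, emb 7 (y + 2) ∈ cells ↔ emb 7 y ∈ cells := fun y => by
    rw [← bumpFun_emb, bumpFun_mem_cells_iff]
  induction n with
  | zero => simp
  | succ n ih =>
    refine Iff.trans ?_ ih
    rw [← step (y + 2 * ((n : ℤ) : ℝ))]
    push_cast
    ring_nf
  | pred n ih =>
    refine Iff.trans ?_ ih
    rw [← step (y + 2 * ((-(n : ℤ) - 1 : ℤ) : ℝ))]
    push_cast
    ring_nf

/-- The homeomorphism that is `twistFun` in the coordinate `emb 7` on `(0, 7)`. -/
noncomputable def twist : HomeoPlus :=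
  (exists_extend_emb (c := 7) (by norm_num) twistFun twistFun_strictMono twistFun_surjective).choose

theorem twist_emb (y : ℝ) : twist (emb 7 y) = emb 7 (twistFun y) :=
  (exists_extend_emb (c := 7) (by norm_num) twistFun twistFun_strictMono
    twistFun_surjective).choose_spec.1 y

theorem twist_of_notMem {x : ℝ} (hx : x ∉ Set.Ioo 0 7) : twist x = x :=
  (exists_extend_emb (c := 7) (by norm_num) twistFun twistFun_strictMono
    twistFun_surjective).choose_spec.2 x hx

theorem twist_of_mem_cells {x : ℝ} (hx : x ∈ cells) : twist x = x := by
  by_cases h : x ∈ Set.Ioo 0 7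
  · obtain ⟨y, rfl⟩ := exists_emb_eq (by norm_num) h
    rw [twist_emb]
    congr 1
    have h1 := Int.floor_le (y / 2)
    have h2 := Int.lt_floor_add_one (y / 2)
    -- Powers of the bump move the point into `[2, 4)`, where `emb 7` is the identity and `cells`
    -- stays in `[2, 3]`, away from the support of the nudge.
    rw [← emb_mem_cells_iff y (1 - ⌊y / 2⌋)] at hx
    push_cast at hx
    rw [emb_of_mem (by linarith) (by linarith)] at hx
    have h3 := le_three_of_mem_cells hx (by linarith)
    rw [twistFun, nudge_of_le (by linarith)]
    ring
  · exact twist_of_notMem h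

theorem twist_comm_bumpAt : twist * bumpAt 0 = bumpAt 0 * twist := by
  refine HomeoPlus.ext fun x => ?_
  simp only [HomeoPlus.mul_apply, bumpAt_apply, sub_zero, add_zero]
  by_cases h : x ∈ Set.Ioo 0 7
  · obtain ⟨y, rfl⟩ := exists_emb_eq (by norm_num) h
    rw [bumpFun_emb, twist_emb, twist_emb, bumpFun_emb, twistFun_add_two]
  · rw [twist_of_notMem h, not_not.1 (mt (bumpFun_ne_iff x).1 h), twist_of_notMem h]

open scoped commutatorElement

/-! ### A homeomorphism common to two consecutive pairs -/

/-- A piecewise linear homeomorphism with support `(2, 5)`. -/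
noncomputable def coreFun (x : ℝ) : ℝ :=
  if x ≤ 2 then x else if x ≤ 8 / 3 then 3 * x - 4 else if x ≤ 3 then x + 4 / 3
  else if x ≤ 5 then x / 3 + 10 / 3 else x

theorem coreFun_strictMono : StrictMono coreFun := by
  intro x y h
  unfold coreFun
  split_ifs <;> linarith

theorem coreFun_surjective : Function.Surjective coreFun := by
  intro y
  rcases le_or_gt y 2 with h | h
  · exact ⟨y, by simp [coreFun, h]⟩
  rcases le_or_gt y 4 with h1 | h1
  · refine ⟨(y + 4) / 3, ?_⟩
    unfold coreFun
    split_ifs <;> linarith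
  rcases le_or_gt y (13 / 3) with h2 | h2
  · refine ⟨y - 4 / 3, ?_⟩
    unfold coreFun
    split_ifs <;> linarith
  rcases le_or_gt y 5 with h3 | h3
  · refine ⟨3 * y - 10, ?_⟩
    unfold coreFun
    split_ifs <;> linarith
  · refine ⟨y, ?_⟩
    unfold coreFun
    split_ifs <;> linarith

/-- The homeomorphism `coreFun`. -/
noncomputable def core : HomeoPlus := HomeoPlus.mk' coreFun coreFun_strictMono coreFun_surjective

theorem core_apply (x : ℝ) : core x = coreFun x := rfl

/-- Clearing inverses leaves positive words, which are compared piece by piece as piecewise linear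
maps. -/
theorem bumpAt_mul_eq_core_mul :
    bumpAt (-4) * bumpAt 0 * bumpAt (-4) = core * bumpAt (-4) * bumpAt (-4) * bumpAt 0 := by
  refine HomeoPlus.ext fun x => ?_
  simp only [HomeoPlus.mul_apply, bumpAt_apply, core_apply, sub_zero, add_zero]
  grind (splits := 80) [bumpFun, coreFun]

theorem bumpAt_mul_eq_mul_core :
    bumpAt 4 * bumpAt 0 * bumpAt 4 = bumpAt 0 * bumpAt 4 * bumpAt 4 * core := by
  refine HomeoPlus.ext fun x => ?_
  simp only [HomeoPlus.mul_apply, bumpAt_apply, core_apply, sub_zero, add_zero]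
  grind (splits := 80) [bumpFun, coreFun]

theorem core_eq_left :
    core = bumpAt (-4) * ⁅bumpAt 0, bumpAt (-4)⁆ * (bumpAt (-4))⁻¹ := by
  have h := bumpAt_mul_eq_core_mul
  rw [commutatorElement_def]
  generalize bumpAt (-4) = a, bumpAt 0 = b at h ⊢
  rw [← mul_inv_eq_iff_eq_mul, ← mul_inv_eq_iff_eq_mul, ← mul_inv_eq_iff_eq_mul] at h
  rw [← h]
  group

theorem core_eq_right :
    core = (bumpAt 4)⁻¹ * ⁅(bumpAt 4)⁻¹, (bumpAt 0)⁻¹⁆ * bumpAt 4 := by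
  have h := bumpAt_mul_eq_mul_core
  rw [commutatorElement_def]
  generalize bumpAt 4 = a, bumpAt 0 = b at h ⊢
  rw [← inv_mul_eq_iff_eq_mul] at h
  rw [show core = a⁻¹ * (a⁻¹ * (b⁻¹ * (b * a * a * core))) by group, ← inv_mul_eq_iff_eq_mul.1 h]
  group

theorem core_twist_ne : core * twist ≠ twist * core := by
  intro h
  -- The gap `(7/3, 8/3)`, on which `twist` is trivial, is carried by `core` onto the gap `(3, 4)`,
  -- on which it is not; 5/2 and 7/2 are the midpoints.
  have h1 : core (twist (5 / 2)) = twist (core (5 / 2)) := by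
    rw [← HomeoPlus.mul_apply, h, HomeoPlus.mul_apply]
  have e1 : twist (5 / 2) = 5 / 2 := by
    have := twist_emb (5 / 2)
    rw [twistFun_of_mem 1 (by norm_num) (by norm_num), nudge_of_le (by norm_num)] at this
    norm_num at this
    rwa [emb_of_mem (by norm_num) (by norm_num)] at this
  have e2 : core (5 / 2) = 7 / 2 := by
    rw [core_apply, coreFun]
    norm_num
  have e3 : twist (7 / 2) = 15 / 4 := by
    have := twist_emb (7 / 2)
    have hn : nudge (3 / 2) = 7 / 4 := by
      unfold nudge
      norm_num
    rw [twistFun_of_mem 1 (by norm_num) (by norm_num)] at this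
    norm_num [hn] at this
    rwa [emb_of_mem (by norm_num) (by norm_num), emb_of_mem (by norm_num) (by norm_num)] at this
  rw [e1, e2, e3] at h1
  norm_num at h1

/-! ### The chain group -/

/-- The generators: consecutive translates of the basic bump, all but the first one conjugated
by `twist`. -/
noncomputable def chainGen (i : ℕ) : HomeoPlus :=
  if i = 0 then bumpAt (-4) else twist * bumpAt (4 * ((i - 1 : ℤ) : ℝ)) * twist⁻¹

theorem chainGen_zero : chainGen 0 = bumpAt (-4) := rfl

theorem chainGen_succ (i : ℕ) : chainGen (i + 1) = twist * bumpAt (4 * i) * twist⁻¹ := by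
  simp [chainGen]

theorem chainGen_one : chainGen 1 = bumpAt 0 := by
  have := chainGen_succ 0
  rw [Nat.cast_zero, mul_zero, twist_comm_bumpAt] at this
  rw [this]
  group

theorem chainGen_two : chainGen 2 = twist * bumpAt 4 * twist⁻¹ := by
  have := chainGen_succ 1
  rwa [Nat.cast_one, mul_one] at this

theorem twist_inv_of_mem_cells {x : ℝ} (hx : x ∈ cells) : twist⁻¹ x = x :=
  HomeoPlus.inv_apply_eq (twist_of_mem_cells hx)

theorem chainGen_mem_cells (i : ℕ) {x : ℝ} (hx : x ∈ cells) :
    chainGen i x ∈ cells ∧ (chainGen i)⁻¹ x ∈ cells := by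
  rcases i with _ | i
  · have h : ∀ x, bumpAt (-4) x ∈ cells ↔ x ∈ cells := fun x => by
      simpa only [Int.cast_neg, Int.cast_one, mul_neg, mul_one] using bumpAt_mem_cells_iff (-1) x
    rw [chainGen_zero]
    exact ⟨(h x).2 hx, (h _).1 (by rwa [HomeoPlus.apply_inv_apply])⟩
  · have h : ∀ x, bumpAt (4 * i) x ∈ cells ↔ x ∈ cells := fun x => by
      simpa only [Int.cast_natCast] using bumpAt_mem_cells_iff i x
    rw [chainGen_succ]
    simp only [mul_inv_rev, inv_inv, HomeoPlus.mul_apply]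
    rw [twist_inv_of_mem_cells hx]
    have h1 := (h x).2 hx
    have h2 := (h ((bumpAt (4 * i))⁻¹ x)).1 (by rwa [HomeoPlus.apply_inv_apply])
    rw [twist_of_mem_cells h1, twist_of_mem_cells h2]
    exact ⟨h1, h2⟩

theorem supp_chainGen (i : ℕ) :
    supp (chainGen i) = Set.Ioo (4 * i - 4 : ℝ) (4 * i + 3) := by
  rcases i with _ | i
  · rw [chainGen_zero, supp_bumpAt]
    norm_num
  · have hl : twist (4 * i) = 4 * i := by
      have := (add_two_mul_mem_cells_iff 0 (2 * i)).2 zero_mem_cells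
      push_cast at this
      rw [zero_add, ← mul_assoc] at this
      norm_num at this
      exact twist_of_mem_cells this
    have hr : twist (4 * i + 7) = 4 * i + 7 := twist_of_notMem fun h => by
      have : (0 : ℝ) ≤ i := i.cast_nonneg
      linarith [h.2]
    ext x
    have h1 : x ∈ supp (chainGen (i + 1)) ↔ twist⁻¹ x ∈ supp (bumpAt (4 * i)) := by
      change chainGen (i + 1) x ≠ x ↔ bumpAt (4 * i) (twist⁻¹ x) ≠ twist⁻¹ x
      rw [chainGen_succ, HomeoPlus.mul_apply, HomeoPlus.mul_apply,
        ← (HomeoPlus.injective twist).ne_iff (x := bumpAt (4 * i) (twist⁻¹ x)),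
        HomeoPlus.apply_inv_apply]
    rw [h1, supp_bumpAt, Set.mem_Ioo, Set.mem_Ioo,
      ← (HomeoPlus.strictMono twist).lt_iff_lt (a := 4 * (i : ℝ)),
      ← (HomeoPlus.strictMono twist).lt_iff_lt (b := 4 * (i : ℝ) + 7),
      HomeoPlus.apply_inv_apply, hl, hr]
    push_cast
    constructor <;> rintro ⟨_, _⟩ <;> constructor <;> linarith

theorem le_chainGen (i : ℕ) (t : ℝ) : t ≤ chainGen i t := by
  have h : ∀ c x : ℝ, x ≤ bumpAt c x := fun c x => by
    rw [bumpAt_apply]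
    linarith [le_bumpFun (x - c)]
  rcases i with _ | i
  · exact h _ _
  · rw [chainGen_succ]
    have := (HomeoPlus.strictMono twist).monotone (h (4 * i) (twist⁻¹ t))
    rwa [HomeoPlus.apply_inv_apply] at this

theorem nonempty_closure_chainGen_equiv (i : ℕ) :
    Nonempty (Subgroup.closure {chainGen i, chainGen (i + 1)} ≃* ThompsonF) := by
  rcases i with _ | i
  · have h := nonempty_closure_bumpAt_equiv (-4)
    rwa [neg_add_cancel, ← chainGen_zero, ← chainGen_one] at h
  · have h := nonempty_closure_bumpAt_equiv (4 * i)
    rw [chainGen_succ, chainGen_succ, Nat.cast_succ, mul_add, mul_one]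
    exact ⟨(nonempty_closure_conj_equiv _ _ _).some.trans h.some⟩

theorem leftEnd_Ioo {a b : ℝ} (h : a < b) : leftEnd (Set.Ioo a b) = a := by
  have e : (fun x : ℝ => (x : EReal)) '' Set.Ioo a b = Set.Ioo (a : EReal) b :=
    EReal.image_coe_Ioo a b
  rw [leftEnd, e]
  exact csInf_Ioo (EReal.coe_lt_coe_iff.2 h)

theorem isPrechain_chainGen {n : ℕ} (hn : 2 ≤ n) : IsPrechain fun i : Fin n => chainGen i where
  two_le := hn
  chain :=
    { isOpen := fun i => by rw [supp_chainGen]; exact isOpen_Ioo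
      ordConnected := fun i => by rw [supp_chainGen]; exact Set.ordConnected_Ioo
      nonempty := fun i => by
        rw [supp_chainGen]
        exact Set.nonempty_Ioo.2 (by linarith)
      disjoint := fun i k h => by
        have h' : (i.val : ℝ) + 2 ≤ k.val := by exact_mod_cast h
        rw [supp_chainGen, supp_chainGen, Set.disjoint_left]
        rintro x ⟨_, h1⟩ ⟨h2, _⟩
        linarith
      inter_nonempty := fun i k h => by
        rw [supp_chainGen, supp_chainGen, ← h]
        push_cast
        refine ⟨4 * i.val + 1, ⟨?_, ?_⟩, ⟨?_, ?_⟩⟩ <;> linarith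
      inter_ssubset_left := fun i k h => by
        rw [supp_chainGen, supp_chainGen, ← h]
        push_cast
        refine Set.ssubset_iff_subset_ne.2 ⟨Set.inter_subset_left, fun he => ?_⟩
        have : (4 * i.val - 1 : ℝ) ∈ Set.Ioo (4 * i.val - 4 : ℝ) (4 * i.val + 3) := by
          constructor <;> linarith
        rw [← he] at this
        linarith [this.2.1]
      inter_ssubset_right := fun i k h => by
        rw [supp_chainGen, supp_chainGen, ← h]
        push_cast
        refine Set.ssubset_iff_subset_ne.2 ⟨Set.inter_subset_right, fun he => ?_⟩
        have : (4 * i.val + 4 : ℝ) ∈ Set.Ioo (4 * (i.val + 1) - 4 : ℝ) (4 * (i.val + 1) + 3) := by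
          constructor <;> linarith
        rw [← he] at this
        linarith [this.1.2] }
  leftEnd_lt := fun i k h => by
    rw [supp_chainGen, supp_chainGen, leftEnd_Ioo (by linarith), leftEnd_Ioo (by linarith),
      EReal.coe_lt_coe_iff, ← h]
    push_cast
    linarith
  le_apply := fun i t => le_chainGen i t

/-- A group whose commutator subgroup contains an element fixing pointwise an invariant set, and
another one that does not, has a commutator subgroup that is not simple. -/
theorem not_isSimpleGroup_commutator {G : Subgroup HomeoPlus} {S : Set ℝ}
    (hS : ∀ g : G, ∀ x ∈ S, (g : HomeoPlus) x ∈ S) {u w : G} (hu : u ∈ commutator G)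
    (hw : w ∈ commutator G) (huS : ∃ x ∈ S, (u : HomeoPlus) x ≠ x) (hw1 : w ≠ 1)
    (hwS : ∀ x ∈ S, (w : HomeoPlus) x = x) : ¬ IsSimpleGroup (commutator G) := by
  intro hs
  let N : Subgroup G :=
    { carrier := {g | ∀ x ∈ S, (g : HomeoPlus) x = x}
      mul_mem' := fun {g k} hg hk x hx => by
        change (g : HomeoPlus) ((k : HomeoPlus) x) = x
        rw [hk x hx, hg x hx]
      one_mem' := fun x _ => rfl
      inv_mem' := fun {g} hg x hx => HomeoPlus.inv_apply_eq (hg x hx) }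
  have hN : N.Normal := ⟨fun g hg k x hx => by
    change (k : HomeoPlus) ((g : HomeoPlus) ((k : HomeoPlus)⁻¹ x)) = x
    have hk : (k : HomeoPlus)⁻¹ x ∈ S := hS k⁻¹ x hx
    rw [hg _ hk, HomeoPlus.apply_inv_apply]⟩
  rcases (inferInstance : (N.subgroupOf (commutator G)).Normal).eq_bot_or_eq_top with h | h
  · have : (⟨w, hw⟩ : commutator G) ∈ N.subgroupOf (commutator G) := hwS
    rw [h, Subgroup.mem_bot] at this
    exact hw1 (congrArg Subtype.val this)
  · have : (⟨u, hu⟩ : commutator G) ∈ N.subgroupOf (commutator G) := by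
      rw [h]
      exact Subgroup.mem_top _
    obtain ⟨x, hx, hne⟩ := huS
    exact hne (this x hx)

/-! ### Non-simplicity of the commutator subgroup -/

theorem closure_chainGen_mem_cells {n : ℕ}
    (g : Subgroup.closure (Set.range fun i : Fin n => chainGen i)) {x : ℝ} (hx : x ∈ cells) :
    (g : HomeoPlus) x ∈ cells := by
  obtain ⟨g, hg⟩ := g
  induction hg using Subgroup.closure_induction'' generalizing x with
  | mem g hg =>
    obtain ⟨i, rfl⟩ := hg
    exact (chainGen_mem_cells i hx).1
  | inv_mem g hg =>
    obtain ⟨i, rfl⟩ := hg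
    exact (chainGen_mem_cells i hx).2
  | one => exact hx
  | mul g k _ _ hg hk => exact hg (hk hx)

theorem not_isSimpleGroup_commutator_closure_chainGen {n : ℕ} (hn : 3 ≤ n) :
    ¬ IsSimpleGroup (commutator (Subgroup.closure (Set.range fun i : Fin n => chainGen i))) := by
  set G := Subgroup.closure (Set.range fun i : Fin n => chainGen i) with hG
  have hmem : ∀ i < n, chainGen i ∈ G := fun i hi => Subgroup.subset_closure ⟨⟨i, hi⟩, rfl⟩
  let a : G := ⟨bumpAt (-4), hmem 0 (by omega)⟩
  let b : G := ⟨bumpAt 0, chainGen_one ▸ hmem 1 (by omega)⟩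
  let c : G := ⟨twist * bumpAt 4 * twist⁻¹, chainGen_two ▸ hmem 2 (by omega)⟩
  have hcomm : ∀ x y : G, ⁅x, y⁆ ∈ commutator G := fun x y =>
    Subgroup.commutator_mem_commutator (Subgroup.mem_top x) (Subgroup.mem_top y)
  have hu : a * ⁅b, a⁆ * a⁻¹ ∈ commutator G :=
    (inferInstance : (commutator G).Normal).conj_mem _ (hcomm b a) a
  have hv : c⁻¹ * ⁅c⁻¹, b⁻¹⁆ * c ∈ commutator G := by
    simpa using (inferInstance : (commutator G).Normal).conj_mem _ (hcomm c⁻¹ b⁻¹) c⁻¹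
  have eu : ((a * ⁅b, a⁆ * a⁻¹ : G) : HomeoPlus) = core := core_eq_left.symm
  have ev : ((c⁻¹ * ⁅c⁻¹, b⁻¹⁆ * c : G) : HomeoPlus) = twist * core * twist⁻¹ := by
    have hb : bumpAt 0 = twist * bumpAt 0 * twist⁻¹ := by
      rw [twist_comm_bumpAt]
      group
    have : ((c⁻¹ * ⁅c⁻¹, b⁻¹⁆ * c : G) : HomeoPlus) = (twist * bumpAt 4 * twist⁻¹)⁻¹ *
        ⁅(twist * bumpAt 4 * twist⁻¹)⁻¹, (bumpAt 0)⁻¹⁆ * (twist * bumpAt 4 * twist⁻¹) := rfl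
    rw [this, hb, core_eq_right, commutatorElement_def, commutatorElement_def]
    group
  -- The element moving a point of `cells` is `core`, which sends 8/3 to 4. The one fixing `cells`
  -- pointwise is `core * (twist * core * twist⁻¹)⁻¹`.
  refine not_isSimpleGroup_commutator (S := cells) (fun g x hx => closure_chainGen_mem_cells g hx)
    hu (mul_mem hu (inv_mem hv)) ⟨8 / 3, ?_, ?_⟩ ?_ ?_
  · have h1 := (div_three_mem_cells_iff (x := 2) (by norm_num) (by norm_num)).2
      (by simpa using (add_two_mem_cells_iff 0).2 zero_mem_cells)
    have h2 := (add_two_mem_cells_iff _).2 h1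
    norm_num at h2
    exact h2
  · rw [eu, core_apply, coreFun]
    norm_num
  · intro h
    rw [mul_inv_eq_one] at h
    have h' : core = twist * core * twist⁻¹ := eu.symm.trans ((congrArg Subtype.val h).trans ev)
    exact core_twist_ne (eq_mul_inv_iff_mul_eq.1 h')
  · intro x hx
    have hinv : core⁻¹ x ∈ cells := by
      have := closure_chainGen_mem_cells (a * ⁅b, a⁆ * a⁻¹)⁻¹ hx
      rwa [Subgroup.coe_inv, eu] at this
    rw [Subgroup.coe_mul, Subgroup.coe_inv, eu, ev]
    simp only [mul_inv_rev, inv_inv, HomeoPlus.mul_apply]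
    rw [twist_inv_of_mem_cells hx, twist_of_mem_cells hinv, HomeoPlus.apply_inv_apply]

end ChainGroups

theorem mainTheorem12 (n : ℕ) (hn : 3 ≤ n) :
    ∃ G : Subgroup ChainGroups.HomeoPlus,
      ChainGroups.IsChainGroup n G ∧ ¬ IsSimpleGroup (commutator G) :=
  ⟨_, ⟨_, ChainGroups.isPrechain_chainGen (by omega), fun i k h => by
    rw [← h]
    exact ChainGroups.nonempty_closure_chainGen_equiv i, rfl⟩,
    ChainGroups.not_isSimpleGroup_commutator_closure_chainGen hn⟩
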